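/- Let $X$ be a separable (real or complex) Banach space, $B_{X^*}$ the closed unit ball of its dual. For $\varepsilon>0$ and a weak$^*$-compact set $K\subset X^*$ put $$\iota_\varepsilon K=K\setminus\bigcup\{V:\ V\subset X^*\text{ weak}^*\text{-open},\ \operatorname{diam}(V\cap K)\le\varepsilon\}$$ (norm diameter), and, if $K$ is moreover convex, let $\hat\iota_\varepsilon K$ be the weak$^*$-closed convex hull of $\iota_\varepsilon K$. Iterate these derivations transfinitely, taking intersections at limit ordinals. Let $\mathrm{Sz}(X,\varepsilon)$ be the least countable ordinal $\alpha$ with $\iota_\varepsilon^\alpha B_{X^*}=\emptyset$ (and $\omega_1$ if there is none), and let $\mathrm{Cz}(X,\varepsilon)$ be defined in the same way from $\hat\iota_\varepsilon$; by convention an index that is at least $\omega_0$ is given the value $\infty$. **Theorem.** (1) There is a universal constant $0<C<10^6$ such that for every separable Banach space $X$ that contains no isomorphic copy of $\ell_1$ and every $0<\tau\le 1$, $$\mathrm{Cz}(X,\tau)\le\sum_{\substack{k\ge 0\\ 2^k\tau/C\le 1}}2^k\,\mathrm{Sz}(X,2^k\tau/C).$$ (2) If $X$ is a separable Banach space, $p>1$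 and $\sup_{0<\varepsilon<1}\varepsilon^p\,\mathrm{Sz}(X,\varepsilon)<\infty$, then $\sup_{0<\varepsilon<1}\varepsilon^p\,\mathrm{Cz}(X,\varepsilon)<\infty$. -/

import Mathlib

open scoped ENNReal

noncomputable section

/-- Transfinite iteration of a derivation `D` on subsets of `E`, starting from `K`:
`D⁰ K = K`, `D^(α+1) K = D (D^α K)`, and `D^α K = ⋂_{β < α} D^β K` at limit ordinals `α`. -/
def iterDerivation {E : Type*} (D : Set E → Set E) (K : Set E) (α : Ordinal.{0}) : Set E :=
  Ordinal.limitRecOn α K (fun _ S => D S) (fun α _ S => ⋂ (β : Ordinal.{0}) (h : β < α), S β h)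

/-- The least countable ordinal `α` such that `D^α K = ∅`, and `ω₁` if there is none. -/
def derivationIndex {E : Type*} (D : Set E → Set E) (K : Set E) : Ordinal.{0} :=
  sInf ({α | α < Ordinal.omega 1 ∧ iterDerivation D K α = ∅} ∪ {Ordinal.omega 1})

section Szlenk

variable (𝕜 : Type*) [RCLike 𝕜] {X : Type*} [NormedAddCommGroup X] [NormedSpace 𝕜 X]

/-- The Szlenk derivation `ι_ε`: remove from `K ⊆ X*` all weak*-open sets `V` for which the
diameter of `V ∩ K` in the dual norm is at most `ε`. -/
def szlenkDerivation (ε : ℝ) (K : Set (WeakDual 𝕜 X)) : Set (WeakDual 𝕜 X) :=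
  K \ ⋃₀ {V : Set (WeakDual 𝕜 X) | IsOpen V ∧
    Metric.ediam (WeakDual.toStrongDual '' (V ∩ K)) ≤ ENNReal.ofReal ε}

/-- The convex Szlenk derivation: the weak*-closed convex hull of `ι_ε K`. -/
def convexSzlenkDerivation (ε : ℝ) (K : Set (WeakDual 𝕜 X)) : Set (WeakDual 𝕜 X) :=
  closure (convexHull ℝ (szlenkDerivation 𝕜 ε K))

variable (X)

/-- The closed unit ball of the dual norm, as a subset of `X*` with the weak* topology. -/
def dualUnitBall : Set (WeakDual 𝕜 X) :=
  WeakDual.toStrongDual ⁻¹' Metric.closedBall 0 1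

/-- The index `Sz(X, ε)` as an ordinal. -/
def szlenkOrdinal (ε : ℝ) : Ordinal.{0} :=
  derivationIndex (szlenkDerivation 𝕜 ε) (dualUnitBall 𝕜 X)

/-- The index `Cz(X, ε)` as an ordinal. -/
def convexSzlenkOrdinal (ε : ℝ) : Ordinal.{0} :=
  derivationIndex (convexSzlenkDerivation 𝕜 ε) (dualUnitBall 𝕜 X)

/-- `Sz(X, ε)`, with the convention that its value is `∞` as soon as the ordinal is at least
the first infinite ordinal. (The cardinality of a finite ordinal `n` is `n`.) -/
def Sz (ε : ℝ) : ℕ∞ := Cardinal.toENat (szlenkOrdinal 𝕜 X ε).card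

/-- `Cz(X, ε)`, with the convention that its value is `∞` as soon as the ordinal is at least
the first infinite ordinal. -/
def Cz (ε : ℝ) : ℕ∞ := Cardinal.toENat (convexSzlenkOrdinal 𝕜 X ε).card

/-- `X` contains `ℓ₁`: there is an isomorphic embedding (a bounded linear map that is bounded
below) of the scalar sequence space `ℓ₁` into `X`. -/
def ContainsEllOne : Prop :=
  ∃ T : lp (fun _ : ℕ => 𝕜) 1 →L[𝕜] X, ∃ c : ℝ, 0 < c ∧ ∀ a, c * ‖a‖ ≤ ‖T a‖

end Szlenk

end

open scoped ENNReal

noncomputable section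

/-! Put σ = τ/16 and let Φ(z) be the sum over k of 2^(k+1)σ times the Szlenk rank of z at scale
2^kσ. Near x in the dual ball no rank rises, and a point at distance d from x loses rank at every
scale below d. The weights turn this into Φ(z) + ‖z - x‖ ≤ Φ(x) + 2σ
(`exists_isOpen_szlenkPotential`).

Let F be the largest convex weak*-lower semicontinuous minorant of -Φ. Its sublevel sets are
weak*-closed and convex, so passing to closed convex hulls costs nothing: it suffices that ι_τ maps
{F ≤ -t} into {F ≤ -t - (τ/4 - 2σ)} (`szlenkDerivation_convexSublevel_subset`). Each step thus gains
τ/8, while Φ < (τ/8) ∑ 2^k Sz(X, 2^kσ), which bounds the number of steps and gives (1) with C = 16.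
For (2), the bound on Sz turns this sum into a geometric series of ratio 2^(1-p). -/

/-! ### Finite indices as finite iterates -/

theorem iterDerivation_natCast {E : Type*} (D : Set E → Set E) (K : Set E) (n : ℕ) :
    iterDerivation D K n = D^[n] K := by
  induction n with
  | zero => simp [iterDerivation]
  | succ n ih =>
    rw [Function.iterate_succ_apply', ← ih, Nat.cast_succ]
    exact Ordinal.limitRecOn_add_one _ _ _ _

theorem derivationIndex_le_of_iterate_eq_empty {E : Type*} {D : Set E → Set E} {K : Set E} {n : ℕ}
    (h : D^[n] K = ∅) : Cardinal.toENat (derivationIndex D K).card ≤ n := by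
  rw [Cardinal.toENat_le_natCast, Ordinal.card_le_nat]
  refine csInf_le' (Or.inl ⟨?_, ?_⟩)
  · exact (Ordinal.natCast_lt_omega0 n).trans_le (Ordinal.omega0_le_omega 1)
  · rw [iterDerivation_natCast, h]

theorem iterate_subset_of_le {E : Type*} {D : Set E → Set E} (hD : ∀ S, D S ⊆ S) (K : Set E)
    {m n : ℕ} (h : m ≤ n) : D^[n] K ⊆ D^[m] K := by
  induction n, h using Nat.le_induction with
  | base => exact subset_rfl
  | succ n _ ih =>
    rw [Function.iterate_succ_apply']
    exact (hD _).trans ih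

theorem iterate_eq_empty_of_derivationIndex_le {E : Type*} {D : Set E → Set E}
    (hD : ∀ S, D S ⊆ S) {K : Set E} {n : ℕ}
    (h : Cardinal.toENat (derivationIndex D K).card ≤ n) : D^[n] K = ∅ := by
  rw [Cardinal.toENat_le_natCast, Ordinal.card_le_nat] at h
  have hmem := csInf_mem (s := {α | α < Ordinal.omega 1 ∧ iterDerivation D K α = ∅} ∪
    {Ordinal.omega 1}) ⟨_, Or.inr rfl⟩
  change derivationIndex D K ∈ _ at hmem
  rcases hmem with ⟨-, he⟩ | he
  · obtain ⟨m, hm⟩ := Ordinal.lt_omega0.1 (h.trans_lt (Ordinal.natCast_lt_omega0 n))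
    rw [hm] at h he
    rw [iterDerivation_natCast] at he
    exact Set.subset_eq_empty (iterate_subset_of_le hD K (by exact_mod_cast h)) he
  · rw [Set.mem_singleton_iff] at he
    rw [he] at h
    exact absurd (h.trans_lt (Ordinal.natCast_lt_omega0 n)) (Ordinal.omega0_le_omega 1).not_gt

/-! ### Szlenk ranks and the potential Φ -/

section Rank

variable (𝕜 : Type*) [RCLike 𝕜] {X : Type*} [NormedAddCommGroup X] [NormedSpace 𝕜 X]

theorem szlenkDerivation_subset (ε : ℝ) (K : Set (WeakDual 𝕜 X)) :
    szlenkDerivation 𝕜 ε K ⊆ K := Set.sdiff_subset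

theorem szlenkDerivation_mono {ε ε' : ℝ} (hε : ε' ≤ ε) {K L : Set (WeakDual 𝕜 X)} (hKL : K ⊆ L) :
    szlenkDerivation 𝕜 ε K ⊆ szlenkDerivation 𝕜 ε' L := by
  rintro z ⟨hz, hzn⟩
  refine ⟨hKL hz, fun ⟨V, ⟨hV, hd⟩, hzV⟩ => hzn ⟨V, ⟨hV, ?_⟩, hzV⟩⟩
  exact (Metric.ediam_mono (Set.image_mono (Set.inter_subset_inter_right V hKL))).trans
    (hd.trans (ENNReal.ofReal_le_ofReal hε))

theorem mem_dualUnitBall {z : WeakDual 𝕜 X} :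
    z ∈ dualUnitBall 𝕜 X ↔ ‖WeakDual.toStrongDual z‖ ≤ 1 := by
  simp [dualUnitBall]

theorem isCompact_dualUnitBall : IsCompact (dualUnitBall 𝕜 X) :=
  WeakDual.isCompact_closedBall 0 1

variable (X) in
theorem Sz_le_iff {ε : ℝ} {n : ℕ} :
    Sz 𝕜 X ε ≤ n ↔ (szlenkDerivation 𝕜 ε)^[n] (dualUnitBall 𝕜 X) = ∅ :=
  ⟨iterate_eq_empty_of_derivationIndex_le (szlenkDerivation_subset 𝕜 ε),
    derivationIndex_le_of_iterate_eq_empty⟩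

variable (X) in
theorem Sz_antitone : Antitone (Sz 𝕜 X) := by
  intro ε' ε hε
  induction h : Sz 𝕜 X ε' using ENat.recTopCoe with
  | top => exact le_top
  | coe n =>
    rw [Sz_le_iff]
    refine Set.subset_eq_empty ?_ ((Sz_le_iff 𝕜 X).1 h.le)
    clear h
    induction n with
    | zero => exact subset_rfl
    | succ n ih =>
      rw [Function.iterate_succ_apply', Function.iterate_succ_apply']
      exact szlenkDerivation_mono 𝕜 hε ih

open scoped Classical in
/-- The largest `j ≤ n` such that `z` belongs to the `j`-th Szlenk derivative of the ball. -/
def szlenkRank (ε : ℝ) (n : ℕ) (z : WeakDual 𝕜 X) : ℕ :=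
  Nat.findGreatest (fun j => z ∈ (szlenkDerivation 𝕜 ε)^[j] (dualUnitBall 𝕜 X)) n

variable {𝕜}

theorem mem_iterate_szlenkRank (ε : ℝ) (n : ℕ) {z : WeakDual 𝕜 X} (hz : z ∈ dualUnitBall 𝕜 X) :
    z ∈ (szlenkDerivation 𝕜 ε)^[szlenkRank 𝕜 ε n z] (dualUnitBall 𝕜 X) := by
  classical
  exact Nat.findGreatest_spec
    (P := fun j => z ∈ (szlenkDerivation 𝕜 ε)^[j] (dualUnitBall 𝕜 X)) (Nat.zero_le n) hz

theorem szlenkRank_lt {ε : ℝ} {n : ℕ}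
    (hn : (szlenkDerivation 𝕜 ε)^[n] (dualUnitBall 𝕜 X) = ∅) {z : WeakDual 𝕜 X}
    (hz : z ∈ dualUnitBall 𝕜 X) : szlenkRank 𝕜 ε n z < n := by
  by_contra! h
  have := iterate_subset_of_le (szlenkDerivation_subset 𝕜 ε) _ h (mem_iterate_szlenkRank ε n hz)
  rw [hn] at this
  exact this

theorem notMem_iterate_szlenkRank_succ {ε : ℝ} {n : ℕ}
    (hn : (szlenkDerivation 𝕜 ε)^[n] (dualUnitBall 𝕜 X) = ∅) {z : WeakDual 𝕜 X}
    (hz : z ∈ dualUnitBall 𝕜 X) :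
    z ∉ (szlenkDerivation 𝕜 ε)^[szlenkRank 𝕜 ε n z + 1] (dualUnitBall 𝕜 X) := by
  classical
  intro h
  have := Nat.le_findGreatest
    (P := fun j => z ∈ (szlenkDerivation 𝕜 ε)^[j] (dualUnitBall 𝕜 X)) (szlenkRank_lt hn hz) h
  exact absurd this (Nat.not_succ_le_self _)

/-- Near a point `x` of the ball the rank is at most that of `x`, and points at distance more than
`ε` from `x` have strictly smaller rank. -/
theorem exists_isOpen_szlenkRank {ε : ℝ} (hε : 0 ≤ ε) {n : ℕ}
    (hn : (szlenkDerivation 𝕜 ε)^[n] (dualUnitBall 𝕜 X) = ∅) {x : WeakDual 𝕜 X}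
    (hx : x ∈ dualUnitBall 𝕜 X) :
    ∃ V : Set (WeakDual 𝕜 X), IsOpen V ∧ x ∈ V ∧ ∀ z ∈ V, z ∈ dualUnitBall 𝕜 X →
      szlenkRank 𝕜 ε n z + (if ε < ‖WeakDual.toStrongDual (z - x)‖ then 1 else 0) ≤
        szlenkRank 𝕜 ε n x := by
  have hxm := mem_iterate_szlenkRank ε n hx
  have hxn := notMem_iterate_szlenkRank_succ hn hx
  set j := szlenkRank 𝕜 ε n x
  rw [Function.iterate_succ_apply'] at hxn
  have : ∃ V : Set (WeakDual 𝕜 X), (IsOpen V ∧ Metric.ediam (WeakDual.toStrongDual ''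
      (V ∩ (szlenkDerivation 𝕜 ε)^[j] (dualUnitBall 𝕜 X))) ≤ ENNReal.ofReal ε) ∧ x ∈ V := by
    by_contra h
    exact hxn ⟨hxm, h⟩
  obtain ⟨V, ⟨hV, hd⟩, hxV⟩ := this
  refine ⟨V, hV, hxV, fun z hzV hz => ?_⟩
  have hzm := mem_iterate_szlenkRank ε n hz
  have hle : szlenkRank 𝕜 ε n z ≤ j := by
    by_contra! h
    have h1 := iterate_subset_of_le (szlenkDerivation_subset 𝕜 ε) _ (Nat.succ_le_of_lt h) hzm
    rw [Function.iterate_succ_apply'] at h1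
    exact h1.2 ⟨V, ⟨hV, hd⟩, hzV⟩
  split_ifs with hd'
  -- Equal ranks would put `z` and `x` in the same slice of the `j`-th derivative, whose diameter is
  -- at most `ε`.
  · refine Nat.succ_le_of_lt (lt_of_le_of_ne hle fun heq => hd'.not_ge ?_)
    rw [heq] at hzm
    have h2 := (Metric.edist_le_ediam_of_mem (Set.mem_image_of_mem _ (Set.mem_inter hzV hzm))
      (Set.mem_image_of_mem _ (Set.mem_inter hxV hxm))).trans hd
    rw [edist_dist, ENNReal.ofReal_le_ofReal_iff hε, dist_eq_norm, ← map_sub] at h2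
    exact h2
  · simpa using hle

/-- The scales below `d` form an initial segment, so their weights add up to 2σ(2^j - 1), where j is
the number of scales counted. -/
theorem min_le_sum_dyadic {σ : ℝ} (hσ : 0 < σ) (d : ℝ) (n : ℕ) :
    min d (2 ^ (n + 1) * σ) - 2 * σ ≤
      ∑ k ∈ Finset.range n, 2 ^ (k + 1) * σ * (if 2 ^ k * σ < d then 1 else 0) := by
  induction n with
  | zero => simp
  | succ n ih =>
    rw [Finset.sum_range_succ]
    have h2 : 0 < 2 ^ n * σ := by positivity
    rw [show (2 : ℝ) ^ (n + 1) * σ = 2 * (2 ^ n * σ) by ring] at *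
    rw [show (2 : ℝ) ^ (n + 1 + 1) * σ = 4 * (2 ^ n * σ) by ring] at *
    split_ifs with h
    · rcases le_total d (2 * (2 ^ n * σ)) with h3 | h3
      · rw [min_eq_left h3] at ih
        have := min_le_left d (4 * (2 ^ n * σ))
        linarith
      · rw [min_eq_right h3] at ih
        have := min_le_right d (4 * (2 ^ n * σ))
        linarith
    · rw [min_eq_left (by linarith)] at ih ⊢
      linarith

/-- The sum of the Szlenk ranks at the scales `2 ^ k * σ`, weighted by twice the scales. -/
def szlenkPotential (σ : ℝ) (m : ℕ) (n : ℕ → ℕ) (z : WeakDual 𝕜 X) : ℝ :=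
  ∑ k ∈ Finset.range m, 2 ^ (k + 1) * σ * szlenkRank 𝕜 (2 ^ k * σ) (n k) z

theorem exists_isOpen_szlenkPotential {σ : ℝ} (hσ : 0 < σ) {m : ℕ} (hm : 1 ≤ 2 ^ m * σ) {n : ℕ → ℕ}
    (hn : ∀ k < m, (szlenkDerivation 𝕜 (2 ^ k * σ))^[n k] (dualUnitBall 𝕜 X) = ∅)
    {x : WeakDual 𝕜 X} (hx : x ∈ dualUnitBall 𝕜 X) :
    ∃ V : Set (WeakDual 𝕜 X), IsOpen V ∧ x ∈ V ∧ ∀ z ∈ V, z ∈ dualUnitBall 𝕜 X →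
      szlenkPotential σ m n z + ‖WeakDual.toStrongDual (z - x)‖ ≤
        szlenkPotential σ m n x + 2 * σ := by
  have h := fun k : Finset.range m => exists_isOpen_szlenkRank (ε := 2 ^ (k : ℕ) * σ)
    (by positivity) (hn k (Finset.mem_range.1 k.2)) hx
  choose V hV hxV hVr using h
  refine ⟨⋂ k, V k, isOpen_iInter_of_finite hV, Set.mem_iInter.2 hxV, fun z hz hzB => ?_⟩
  rw [Set.mem_iInter] at hz
  set d := ‖WeakDual.toStrongDual (z - x)‖ with hd
  have hd2 : d ≤ 2 := by
    rw [hd, map_sub]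
    have h1 := norm_sub_le (WeakDual.toStrongDual z) (WeakDual.toStrongDual x)
    have h2 := (mem_dualUnitBall 𝕜).1 hzB
    have h3 := (mem_dualUnitBall 𝕜).1 hx
    linarith
  -- Since `d ≤ 2 ≤ 2 ^ (m + 1) * σ`, the `m` scales suffice to recover all of `d`.
  have hmin := min_le_sum_dyadic hσ d m
  rw [min_eq_left (by rw [pow_succ]; linarith)] at hmin
  have hsum : szlenkPotential σ m n z + ∑ k ∈ Finset.range m,
      2 ^ (k + 1) * σ * (if 2 ^ k * σ < d then 1 else 0) ≤ szlenkPotential σ m n x := by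
    rw [szlenkPotential, szlenkPotential, ← Finset.sum_add_distrib]
    refine Finset.sum_le_sum fun k hk => ?_
    rw [← mul_add]
    refine mul_le_mul_of_nonneg_left ?_ (by positivity)
    have := hVr ⟨k, hk⟩ z (hz _) hzB
    exact_mod_cast this
  linarith

theorem szlenkPotential_nonneg {σ : ℝ} (hσ : 0 < σ) (m : ℕ) (n : ℕ → ℕ) (z : WeakDual 𝕜 X) :
    0 ≤ szlenkPotential σ m n z :=
  Finset.sum_nonneg fun _ _ => by positivity

theorem szlenkPotential_le {σ : ℝ} (hσ : 0 < σ) {m : ℕ} {n : ℕ → ℕ}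
    (hn : ∀ k < m, (szlenkDerivation 𝕜 (2 ^ k * σ))^[n k] (dualUnitBall 𝕜 X) = ∅)
    {z : WeakDual 𝕜 X} (hz : z ∈ dualUnitBall 𝕜 X) :
    szlenkPotential σ m n z ≤ ∑ k ∈ Finset.range m, 2 ^ (k + 1) * σ * ((n k : ℝ) - 1) := by
  refine Finset.sum_le_sum fun k hk => mul_le_mul_of_nonneg_left ?_ (by positivity)
  have := szlenkRank_lt (hn k (Finset.mem_range.1 hk)) hz
  rw [le_sub_iff_add_le]
  exact_mod_cast this

end Rank

/-! ### Convexification by duality -/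

section Sublevel

variable (𝕜 : Type*) [RCLike 𝕜] {X : Type*} [NormedAddCommGroup X] [NormedSpace 𝕜 X]

/-- The set where the largest convex weak*-lower semicontinuous minorant of `-Φ` on the dual unit
ball is at most `-t`. -/
def convexSublevel (Φ : WeakDual 𝕜 X → ℝ) (t : ℝ) : Set (WeakDual 𝕜 X) :=
  {z | ∀ (x : X) (c : ℝ), (∀ w ∈ dualUnitBall 𝕜 X, RCLike.re (w x) + Φ w ≤ c) →
    RCLike.re (z x) ≤ c - t}

variable {𝕜} {Φ : WeakDual 𝕜 X → ℝ}

theorem continuous_re_eval (x : X) : Continuous fun z : WeakDual 𝕜 X => RCLike.re (z x) :=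
  RCLike.continuous_re.comp (WeakDual.eval_continuous x)

theorem isClosed_convexSublevel (t : ℝ) : IsClosed (convexSublevel 𝕜 Φ t) := by
  simp only [convexSublevel, Set.ofPred_forall]
  exact isClosed_iInter fun x => isClosed_iInter fun c => isClosed_iInter fun _ =>
    isClosed_le (continuous_re_eval x) continuous_const

theorem convex_convexSublevel (t : ℝ) : Convex ℝ (convexSublevel 𝕜 Φ t) := by
  intro z hz w hw a b ha hb hab x c h
  have h1 := mul_le_mul_of_nonneg_left (hz x c h) ha
  have h2 := mul_le_mul_of_nonneg_left (hw x c h) hb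
  have h3 : (a • z + b • w) x = a • z x + b • w x := rfl
  rw [h3, map_add, RCLike.smul_re, RCLike.smul_re]
  calc _ ≤ a * (c - t) + b * (c - t) := add_le_add h1 h2
    _ = c - t := by rw [← add_mul, hab, one_mul]

theorem dualUnitBall_subset_convexSublevel (hΦ : ∀ z, 0 ≤ Φ z) :
    dualUnitBall 𝕜 X ⊆ convexSublevel 𝕜 Φ 0 := by
  intro z hz x c h
  have := h z hz
  linarith [hΦ z]

theorem convexSublevel_eq_empty {M t : ℝ} (hM : ∀ z ∈ dualUnitBall 𝕜 X, Φ z ≤ M) (ht : M < t) :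
    convexSublevel 𝕜 Φ t = ∅ := by
  rw [Set.eq_empty_iff_forall_notMem]
  intro z hz
  -- Testing against constants alone is enough.
  have := hz 0 M (by simpa using hM)
  rw [map_zero, map_zero] at this
  linarith

theorem re_apply_le_norm_sub (z w : WeakDual 𝕜 X) {y : X} (hy : ‖y‖ ≤ 1) :
    RCLike.re (z y) ≤ ‖WeakDual.toStrongDual (z - w)‖ + ‖w y‖ := by
  have h1 : z y = WeakDual.toStrongDual (z - w) y + w y := by
    rw [map_sub]
    exact (sub_add_cancel (z y) (w y)).symm
  calc RCLike.re (z y) ≤ ‖z y‖ := RCLike.re_le_norm _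
    _ ≤ ‖WeakDual.toStrongDual (z - w) y‖ + ‖w y‖ := h1 ▸ norm_add_le _ _
    _ ≤ _ := by
      gcongr
      exact (WeakDual.toStrongDual (z - w)).unit_le_opNorm y hy

/-- The support function of `Φ` grows by at most about `s` under perturbations from the unit ball
that are almost annihilated by a suitable finite set of functionals. -/
theorem exists_finite_forall_re_add_le {s : ℝ}
    (hΦ : ∀ x ∈ dualUnitBall 𝕜 X, ∃ V : Set (WeakDual 𝕜 X), IsOpen V ∧ x ∈ V ∧ ∀ z ∈ V,
      z ∈ dualUnitBall 𝕜 X → Φ z + ‖WeakDual.toStrongDual (z - x)‖ ≤ Φ x + s)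
    {x : X} {c : ℝ} (hc : ∀ w ∈ dualUnitBall 𝕜 X, RCLike.re (w x) + Φ w ≤ c)
    {η : ℝ} (hη : 0 < η) :
    ∃ S : Finset (WeakDual 𝕜 X), ∀ y : X, ‖y‖ ≤ 1 → (∀ f ∈ S, ‖f y‖ ≤ η) →
      ∀ w ∈ dualUnitBall 𝕜 X, RCLike.re (w (x + y)) + Φ w ≤ c + s + 2 * η := by
  have hΦ' : ∀ f ∈ dualUnitBall 𝕜 X, ∃ V ∈ nhdsWithin f (dualUnitBall 𝕜 X), ∀ z ∈ V,
      z ∈ dualUnitBall 𝕜 X → Φ z + ‖WeakDual.toStrongDual (z - f)‖ ≤ Φ f + s ∧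
        RCLike.re (z x) < RCLike.re (f x) + η := by
    intro f hf
    obtain ⟨V, hV, hfV, h⟩ := hΦ f hf
    refine ⟨V ∩ {z | RCLike.re (z x) < RCLike.re (f x) + η}, mem_nhdsWithin_of_mem_nhds
      (Filter.inter_mem (hV.mem_nhds hfV) ((isOpen_lt (continuous_re_eval x)
        continuous_const).mem_nhds ?_)), fun z hz hzB => ⟨h z hz.1 hzB, hz.2⟩⟩
    exact lt_add_of_pos_right _ hη
  choose! V hV hVp using hΦ'
  obtain ⟨S, hSB, hS⟩ := (isCompact_dualUnitBall 𝕜 (X := X)).elim_nhdsWithin_subcover V hV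
  refine ⟨S, fun y hy hyS w hw => ?_⟩
  obtain ⟨f, hf, hwf⟩ := Set.mem_iUnion₂.1 (hS hw)
  obtain ⟨h1, h2⟩ := hVp f (hSB f hf) w hwf hw
  have h3 := hc f (hSB f hf)
  have h4 := re_apply_le_norm_sub w f hy
  have h5 := hyS f hf
  rw [map_add, map_add]
  linarith

/-- The unit ball of `X` is totally bounded for the seminorms given by finitely many functionals. -/
theorem exists_finset_approx_unitBall (S : Finset (WeakDual 𝕜 X)) {η : ℝ} (hη : 0 < η) :
    ∃ T : Finset X, (∀ v ∈ T, ‖v‖ ≤ 1) ∧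
      ∀ u : X, ‖u‖ ≤ 1 → ∃ v ∈ T, ∀ f ∈ S, ‖f (u - v)‖ ≤ η := by
  classical
  let φ : X → (S → 𝕜) := fun u f => f.1 u
  have hbdd : Bornology.IsBounded (φ '' Metric.closedBall 0 1) := by
    rw [← Bornology.forall_isBounded_image_eval_iff]
    intro f
    rw [isBounded_iff_forall_norm_le]
    refine ⟨‖WeakDual.toStrongDual f.1‖, ?_⟩
    rintro _ ⟨_, ⟨u, hu, rfl⟩, rfl⟩
    exact (WeakDual.toStrongDual f.1).unit_le_opNorm u (by simpa using hu)
  obtain ⟨t, hts, htf, ht⟩ := Metric.finite_approx_of_totallyBounded 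
    (hbdd.isCompact_closure.totallyBounded.subset subset_closure) η hη
  have hts' : ∀ y ∈ t, ∃ u ∈ Metric.closedBall (0 : X) 1, φ u = y := fun y hy => hts hy
  choose! g hg using hts'
  refine ⟨htf.toFinset.image g, fun v hv => ?_, fun u hu => ?_⟩
  · obtain ⟨y, hy, rfl⟩ := Finset.mem_image.1 hv
    simpa using (hg _ (htf.mem_toFinset.1 hy)).1
  · have hmem := ht (Set.mem_image_of_mem φ (show u ∈ Metric.closedBall 0 1 by simpa using hu))
    obtain ⟨y, hy, hd⟩ := Set.mem_iUnion₂.1 hmem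
    refine ⟨g y, Finset.mem_image_of_mem g (htf.mem_toFinset.2 hy), fun f hf => ?_⟩
    rw [Metric.mem_ball, ← (hg y hy).2] at hd
    rw [map_sub, ← dist_eq_norm]
    exact (dist_le_pi_dist (φ u) (φ (g y)) ⟨f, hf⟩).trans hd.le

theorem exists_unit_lt_re (g : StrongDual 𝕜 X) {r : ℝ} (hr : r < ‖g‖) (hr0 : 0 ≤ r) :
    ∃ u : X, ‖u‖ ≤ 1 ∧ r < RCLike.re (g u) := by
  obtain ⟨u, hu, hru⟩ := g.exists_lt_apply_of_lt_opNorm hr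
  have hne : g u ≠ 0 := norm_pos_iff.1 (hr0.trans_lt hru)
  have hne' : (‖g u‖ : 𝕜) ≠ 0 := by simpa using hne
  -- Rotate `u` by a unimodular scalar so that `g u` becomes real and positive.
  refine ⟨((starRingEnd 𝕜) (g u) / (‖g u‖ : 𝕜)) • u, ?_, ?_⟩
  · rw [norm_smul, norm_div, RCLike.norm_conj, RCLike.norm_ofReal, abs_norm,
      div_self (norm_ne_zero_iff.2 hne), one_mul]
    exact hu.le
  · rw [map_smul, smul_eq_mul, div_mul_eq_mul_div, RCLike.conj_mul, sq, mul_div_assoc,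
      div_self hne', mul_one, RCLike.ofReal_re]
    exact hru

theorem exists_mem_of_mem_szlenkDerivation {τ : ℝ} {K V : Set (WeakDual 𝕜 X)}
    {z₀ : WeakDual 𝕜 X} (hz₀ : z₀ ∈ szlenkDerivation 𝕜 τ K) (hV : IsOpen V) (hzV : z₀ ∈ V) :
    ∃ z ∈ V ∩ K, τ / 2 < ‖WeakDual.toStrongDual (z - z₀)‖ := by
  by_contra! h
  refine hz₀.2 ⟨V, ⟨hV, Metric.ediam_le ?_⟩, hzV⟩
  rintro _ ⟨a, ha, rfl⟩ _ ⟨b, hb, rfl⟩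
  rw [edist_dist]
  refine ENNReal.ofReal_le_ofReal ?_
  have h1 := h a ha
  have h2 := h b hb
  rw [map_sub, ← dist_eq_norm] at h1 h2
  linarith [dist_triangle_right (WeakDual.toStrongDual a) (WeakDual.toStrongDual b)
    (WeakDual.toStrongDual z₀)]

/-- Near z₀ there is z in the sublevel set with ‖z - z₀‖ > τ/2, nearly attained at some u.
Perturbing x by a y nearly annihilated by finitely many functionals raises the support function of Φ
by about s at most, but z(y) can be about τ/4; testing z at x + y lowers the bound on z₀(x) by τ/4 -
s. -/
theorem szlenkDerivation_convexSublevel_subset {s : ℝ}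
    (hΦ : ∀ x ∈ dualUnitBall 𝕜 X, ∃ V : Set (WeakDual 𝕜 X), IsOpen V ∧ x ∈ V ∧ ∀ z ∈ V,
      z ∈ dualUnitBall 𝕜 X → Φ z + ‖WeakDual.toStrongDual (z - x)‖ ≤ Φ x + s)
    {τ : ℝ} (hτ : 0 ≤ τ) (t : ℝ) :
    szlenkDerivation 𝕜 τ (convexSublevel 𝕜 Φ t) ⊆ convexSublevel 𝕜 Φ (t + (τ / 4 - s)) := by
  classical
  intro z₀ hz₀ x c hc
  refine le_of_forall_pos_le_add fun δ hδ => ?_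
  obtain ⟨η, hη, rfl⟩ : ∃ η, 0 < η ∧ δ = 5 * η := ⟨δ / 5, by positivity, by ring⟩
  obtain ⟨S, hS⟩ := exists_finite_forall_re_add_le hΦ hc hη
  -- The vector `u` depends on `z`, so the finite net `T` is fixed beforehand and the neighbourhood
  -- controls `z` on it. Then `y = (u - v) / 2` is in the unit ball; the halving turns τ/2 into τ/4.
  obtain ⟨T, hT1, hT⟩ := exists_finset_approx_unitBall (insert z₀ S) hη
  have hV : IsOpen ({z : WeakDual 𝕜 X | RCLike.re (z₀ x) - η < RCLike.re (z x)} ∩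
      ⋂ v ∈ T, {z : WeakDual 𝕜 X | RCLike.re (z v) < RCLike.re (z₀ v) + η}) :=
    (isOpen_lt continuous_const (continuous_re_eval x)).inter
      (isOpen_biInter_finset fun v _ => isOpen_lt (continuous_re_eval v) continuous_const)
  obtain ⟨z, ⟨⟨hzx, hzT⟩, hzK⟩, hd⟩ := exists_mem_of_mem_szlenkDerivation hz₀ hV
    ⟨sub_lt_self _ hη, Set.mem_iInter₂.2 fun v _ => lt_add_of_pos_right _ hη⟩
  obtain ⟨u, hu, hur⟩ := exists_unit_lt_re _ hd (by positivity)
  obtain ⟨v, hv, huv⟩ := hT u hu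
  have hzv : RCLike.re (z v) < RCLike.re (z₀ v) + η := Set.mem_iInter₂.1 hzT v hv
  have hur' : τ / 2 < RCLike.re (z u) - RCLike.re (z₀ u) := by
    rw [map_sub] at hur
    rw [← map_sub]
    exact hur
  have hhalf : ∀ f : WeakDual 𝕜 X, f ((1 / 2 : 𝕜) • (u - v)) = (1 / 2 : 𝕜) * f (u - v) :=
    fun f => by rw [map_smul, smul_eq_mul]
  have hhalf_norm : ‖(1 / 2 : 𝕜)‖ = 1 / 2 := by simp
  have hre : ∀ a : 𝕜, RCLike.re ((1 / 2 : 𝕜) * a) = 1 / 2 * RCLike.re a := fun a => by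
    have : (1 / 2 : 𝕜) = ((1 / 2 : ℝ) : 𝕜) := by push_cast; rfl
    rw [this, RCLike.re_ofReal_mul]
  have hy1 : ‖(1 / 2 : 𝕜) • (u - v)‖ ≤ 1 := by
    rw [norm_smul, hhalf_norm]
    linarith [norm_sub_le u v, hT1 v hv]
  have hyS : ∀ f ∈ insert z₀ S, ‖f ((1 / 2 : 𝕜) • (u - v))‖ ≤ η := fun f hf => by
    rw [hhalf, norm_mul, hhalf_norm]
    linarith [huv f hf]
  have h1 := hzK _ _ (hS _ hy1 fun f hf => hyS f (Finset.mem_insert_of_mem hf))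
  have h2 := (neg_le_abs _).trans ((RCLike.abs_re_le_norm _).trans
    (hyS z₀ (Finset.mem_insert_self _ _)))
  rw [hhalf, hre, map_sub, map_sub] at h2
  rw [map_add, map_add, hhalf, hre, map_sub, map_sub] at h1
  change RCLike.re (z₀ x) - η < RCLike.re (z x) at hzx
  linarith

theorem iterate_convexSzlenkDerivation_subset {s : ℝ}
    (hΦ : ∀ x ∈ dualUnitBall 𝕜 X, ∃ V : Set (WeakDual 𝕜 X), IsOpen V ∧ x ∈ V ∧ ∀ z ∈ V,
      z ∈ dualUnitBall 𝕜 X → Φ z + ‖WeakDual.toStrongDual (z - x)‖ ≤ Φ x + s)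
    (hΦ0 : ∀ z, 0 ≤ Φ z) {τ : ℝ} (hτ : 0 ≤ τ) (n : ℕ) :
    (convexSzlenkDerivation 𝕜 τ)^[n] (dualUnitBall 𝕜 X) ⊆
      convexSublevel 𝕜 Φ (n * (τ / 4 - s)) := by
  induction n with
  | zero => simpa using dualUnitBall_subset_convexSublevel hΦ0
  | succ n ih =>
    rw [Function.iterate_succ_apply']
    refine closure_minimal (convexHull_min ?_ (convex_convexSublevel _)) (isClosed_convexSublevel _)
    refine (szlenkDerivation_mono 𝕜 le_rfl ih).trans ?_
    rw [Nat.cast_succ, add_one_mul]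
    exact szlenkDerivation_convexSublevel_subset hΦ hτ _

end Sublevel

/-! ### Comparison of the indices -/

section Indices

variable (𝕜 : Type*) [RCLike 𝕜] (X : Type*) [NormedAddCommGroup X] [NormedSpace 𝕜 X]

theorem Cz_le_of_Sz_le {τ : ℝ} (hτ : 0 < τ) {m : ℕ} (hm0 : 0 < m) (hm : 1 ≤ 2 ^ m * (τ / 16))
    {n : ℕ → ℕ} (hn : ∀ k < m, Sz 𝕜 X (2 ^ k * (τ / 16)) ≤ n k) :
    Cz 𝕜 X τ ≤ (∑ k ∈ Finset.range m, 2 ^ k * n k : ℕ) := by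
  have hn' : ∀ k < m,
      (szlenkDerivation 𝕜 (2 ^ k * (τ / 16)))^[n k] (dualUnitBall 𝕜 X) = ∅ :=
    fun k hk => (Sz_le_iff 𝕜 X).1 (hn k hk)
  have hσ : 0 < τ / 16 := by positivity
  refine derivationIndex_le_of_iterate_eq_empty (Set.subset_eq_empty
    (iterate_convexSzlenkDerivation_subset (s := 2 * (τ / 16))
      (fun x hx => exists_isOpen_szlenkPotential hσ hm hn' hx)
      (szlenkPotential_nonneg hσ m n) hτ.le _)
    (convexSublevel_eq_empty (fun z hz => szlenkPotential_le hσ hn' hz) ?_))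
  have h1 : ∑ k ∈ Finset.range m, (2 : ℝ) ^ (k + 1) * (τ / 16) * ((n k : ℝ) - 1) =
      τ / 8 * (∑ k ∈ Finset.range m, (2 : ℝ) ^ k * n k - ∑ k ∈ Finset.range m, (2 : ℝ) ^ k) := by
    rw [← Finset.sum_sub_distrib, Finset.mul_sum]
    exact Finset.sum_congr rfl fun k _ => by ring
  -- Ranks are at most `n k - 1`; this slack gives the strict inequality needed for emptiness.
  have h2 : 0 < ∑ k ∈ Finset.range m, (2 : ℝ) ^ k :=
    Finset.sum_pos (fun _ _ => by positivity) (Finset.nonempty_range_iff.2 hm0.ne')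
  rw [h1]
  push_cast
  nlinarith

theorem tsum_scales_eq_tsum_indicator (τ : ℝ) :
    ∑' k : {k : ℕ // 2 ^ k * τ / 16 ≤ 1},
      2 ^ (k : ℕ) * (Sz 𝕜 X (2 ^ (k : ℕ) * τ / 16) : ℝ≥0∞) =
    ∑' k : ℕ, Set.indicator {k : ℕ | 2 ^ k * τ / 16 ≤ 1}
      (fun k => 2 ^ k * (Sz 𝕜 X (2 ^ k * τ / 16) : ℝ≥0∞)) k :=
  tsum_subtype {k : ℕ | 2 ^ k * τ / 16 ≤ 1}
    fun k => 2 ^ k * (Sz 𝕜 X (2 ^ k * τ / 16) : ℝ≥0∞)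

theorem Cz_le_tsum {τ : ℝ} (hτ : 0 < τ) (hτ1 : τ ≤ 1) :
    (Cz 𝕜 X τ : ℝ≥0∞) ≤ ∑' k : {k : ℕ // 2 ^ k * τ / 16 ≤ 1},
      2 ^ (k : ℕ) * (Sz 𝕜 X (2 ^ (k : ℕ) * τ / 16) : ℝ≥0∞) := by
  by_cases htop : ∃ k : {k : ℕ // 2 ^ k * τ / 16 ≤ 1}, Sz 𝕜 X (2 ^ (k : ℕ) * τ / 16) = ⊤
  · obtain ⟨k, hk⟩ := htop
    refine le_top.trans (le_trans ?_ (ENNReal.le_tsum k))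
    simp [hk, ENNReal.mul_top]
  push Not at htop
  have hex : ∃ k : ℕ, 1 < 2 ^ k * τ / 16 := by
    obtain ⟨k, hk⟩ := pow_unbounded_of_one_lt (16 / τ) (one_lt_two (α := ℝ))
    exact ⟨k, by rwa [lt_div_iff₀ (by norm_num), one_mul, ← div_lt_iff₀ hτ]⟩
  classical
  -- The scales `k < m` are exactly those at most 1; `τ ≤ 1` forces `m > 0`.
  set m := Nat.find hex
  have hlt : ∀ k < m, 2 ^ k * τ / 16 ≤ 1 := fun k hk => not_lt.1 (Nat.find_min hex hk)
  have hm : 1 < 2 ^ m * τ / 16 := Nat.find_spec hex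
  have hm0 : 0 < m := by
    rw [Nat.pos_iff_ne_zero]
    intro h
    rw [h] at hm
    linarith
  have hC := Cz_le_of_Sz_le 𝕜 X hτ hm0 (by rw [← mul_div_assoc]; exact hm.le)
    (n := fun k => (Sz 𝕜 X (2 ^ k * τ / 16)).toNat) fun k hk => by
      rw [← mul_div_assoc, ENat.natCast_toNat (htop ⟨k, hlt k hk⟩)]
  refine (ENat.toENNReal_le.2 hC).trans ?_
  rw [tsum_scales_eq_tsum_indicator]
  refine le_trans ?_ (ENNReal.sum_le_tsum (Finset.range m))
  rw [ENat.toENNReal_coe, Nat.cast_sum]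
  refine Finset.sum_le_sum fun k hk => ?_
  have hk' := hlt k (Finset.mem_range.1 hk)
  rw [Set.indicator_of_mem (show k ∈ {k : ℕ | 2 ^ k * τ / 16 ≤ 1} from hk')]
  push_cast
  rw [← ENat.toENNReal_coe, ENat.natCast_toNat (htop ⟨k, hk'⟩)]

theorem ofReal_rpow_mul_Cz_le {p : ℝ} {A : ℝ≥0∞}
    (hA : ∀ ε ∈ Set.Ioo (0 : ℝ) 1, ENNReal.ofReal (ε ^ p) * (Sz 𝕜 X ε : ℝ≥0∞) ≤ A)
    {τ : ℝ} (hτ : τ ∈ Set.Ioo (0 : ℝ) 1) :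
    ENNReal.ofReal (τ ^ p) * (Cz 𝕜 X τ : ℝ≥0∞) ≤
      ENNReal.ofReal (32 ^ p) * A * ∑' k : ℕ, ENNReal.ofReal (2 ^ (1 - p)) ^ k := by
  have hτ0 := hτ.1
  refine (mul_le_mul_right (Cz_le_tsum 𝕜 X hτ0 hτ.2.le) _).trans ?_
  rw [tsum_scales_eq_tsum_indicator, ← ENNReal.tsum_mul_left,
    ← ENNReal.tsum_mul_left]
  refine ENNReal.tsum_le_tsum fun k => ?_
  rw [Set.indicator_apply]
  split_ifs with hk
  · have hk' : 2 ^ k * τ / 16 ≤ 1 := hk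
    have hpos : 0 < 2 ^ k * τ / 32 := by positivity
    -- The scale may equal 1, outside the open interval of the hypothesis; halving it brings it
    -- inside, whence the factor `32 ^ p`.
    have hS : Sz 𝕜 X (2 ^ k * τ / 16) ≤ Sz 𝕜 X (2 ^ k * τ / 32) :=
      Sz_antitone 𝕜 X (by linarith)
    have hb := hA (2 ^ k * τ / 32) ⟨hpos, by linarith⟩
    have hreal : τ ^ p * 2 ^ k = 32 ^ p * (2 ^ (1 - p)) ^ k * (2 ^ k * τ / 32) ^ p := by
      rw [Real.div_rpow (by positivity) (by positivity), Real.mul_rpow (by positivity) hτ0.le,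
        Real.rpow_sub two_pos, Real.rpow_one, div_pow, ← Real.rpow_natCast ((2 : ℝ) ^ p),
        ← Real.rpow_natCast (2 : ℝ) k, ← Real.rpow_mul two_pos.le, ← Real.rpow_mul two_pos.le,
        mul_comm (k : ℝ) p]
      field_simp
    have hcoef : ENNReal.ofReal (τ ^ p) * 2 ^ k = ENNReal.ofReal (32 ^ p) *
        ENNReal.ofReal (2 ^ (1 - p)) ^ k * ENNReal.ofReal ((2 ^ k * τ / 32) ^ p) := by
      rw [← ENNReal.ofReal_pow (by positivity), ← ENNReal.ofReal_mul (by positivity),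
        ← ENNReal.ofReal_mul (by positivity), ← hreal, ENNReal.ofReal_mul (by positivity),
        ENNReal.ofReal_pow two_pos.le, ENNReal.ofReal_ofNat]
    calc ENNReal.ofReal (τ ^ p) * (2 ^ k * (Sz 𝕜 X (2 ^ k * τ / 16) : ℝ≥0∞))
        ≤ ENNReal.ofReal (τ ^ p) * (2 ^ k * (Sz 𝕜 X (2 ^ k * τ / 32) : ℝ≥0∞)) := by
          gcongr
      _ = ENNReal.ofReal (32 ^ p) * ENNReal.ofReal (2 ^ (1 - p)) ^ k *
          (ENNReal.ofReal ((2 ^ k * τ / 32) ^ p) * (Sz 𝕜 X (2 ^ k * τ / 32) : ℝ≥0∞)) := by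
          rw [← mul_assoc, hcoef, mul_assoc]
      _ ≤ ENNReal.ofReal (32 ^ p) * ENNReal.ofReal (2 ^ (1 - p)) ^ k * A := by gcongr
      _ = _ := mul_right_comm _ _ _
  · simp

end Indices

end

theorem theorem4p4 :
    (∃ C : ℝ, 0 < C ∧ C < 10 ^ 6 ∧
      ∀ (𝕜 : Type*) [RCLike 𝕜] (X : Type*) [NormedAddCommGroup X] [NormedSpace 𝕜 X]
        [CompleteSpace X] [TopologicalSpace.SeparableSpace X],
        ¬ ContainsEllOne 𝕜 X →
        ∀ τ : ℝ, 0 < τ → τ ≤ 1 →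
          (Cz 𝕜 X τ : ℝ≥0∞) ≤
            ∑' k : {k : ℕ // 2 ^ k * τ / C ≤ 1},
              2 ^ (k : ℕ) * (Sz 𝕜 X (2 ^ (k : ℕ) * τ / C) : ℝ≥0∞)) ∧
    (∀ (𝕜 : Type*) [RCLike 𝕜] (X : Type*) [NormedAddCommGroup X] [NormedSpace 𝕜 X]
        [CompleteSpace X] [TopologicalSpace.SeparableSpace X] (p : ℝ), 1 < p →
        (⨆ ε ∈ Set.Ioo (0 : ℝ) 1, ENNReal.ofReal (ε ^ p) * (Sz 𝕜 X ε : ℝ≥0∞)) < ⊤ →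
        (⨆ ε ∈ Set.Ioo (0 : ℝ) 1, ENNReal.ofReal (ε ^ p) * (Cz 𝕜 X ε : ℝ≥0∞)) < ⊤) := by
  refine ⟨⟨16, by norm_num, by norm_num, fun 𝕜 _ X _ _ _ _ _ τ hτ hτ1 => Cz_le_tsum 𝕜 X hτ hτ1⟩,
    fun 𝕜 _ X _ _ _ _ p hp h => ?_⟩
  refine lt_of_le_of_lt (iSup₂_le fun τ hτ => ofReal_rpow_mul_Cz_le 𝕜 X
    (fun ε hε => le_iSup₂ (f := fun (ε : ℝ) (_ : ε ∈ Set.Ioo (0 : ℝ) 1) =>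
      ENNReal.ofReal (ε ^ p) * (Sz 𝕜 X ε : ℝ≥0∞)) ε hε) hτ) ?_
  refine ENNReal.mul_lt_top (ENNReal.mul_lt_top ENNReal.ofReal_lt_top h) ?_
  rw [ENNReal.tsum_geometric, ENNReal.inv_lt_top, tsub_pos_iff_lt, ← ENNReal.ofReal_one]
  exact (ENNReal.ofReal_lt_ofReal_iff one_pos).2
    (Real.rpow_lt_one_of_one_lt_of_neg one_lt_two (by linarith))
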